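/- **Theorem (State Machine Safety of MongoRaftReconfig).** Let $Server$ be a finite set. A *state* consists of functions on $Server$: $log[s]$ (a finite sequence of natural numbers, indexed from $1$; $log[s][i]$ is the term of the $i$-th entry), $term[s]\in\mathbb N$, $state[s]\in\{Primary,Secondary\}$, and a configuration, given by its member set $config[s]\subseteq Server$, $configVersion[s]\in\mathbb N$ and $configTerm[s]\in\mathbb N$; together with a set $committed\subseteq\mathbb N\times\mathbb N$ of committed entries, written as $(index, term)$ pairs. $Quorums(m)$ is the set of $Q\subseteq m$ with $2|Q|>|m|$. The last term of a log is the term of its last entry, or $0$ if the log is empty. The entry $(i,t)$ is in the log of $s$ if $1\le i\le Len(log[s])$ and $log[s][i]=t$. It is *immediately committed* on $Q$ if every $v\in Q$ has it in its log and has $term[v]=t$. Configurations are compared by $configTerm$ first, then by $configVersion$. $MRRInit$: all logs are empty, $committed=\emptyset$, all servers are secondaries with term $0$, and all have the same non-empty member set, configuration version $1$ and configuration term $0$. $MRRNext$: for some $s,t\in Server$ and $Q\in Quorums(config[s])$, one of the following happens (what is not mentioned is unchanged): - $ClientRequest(s)$: $s$ is primary and appends $term[s]$ to $log[s]$. - $GetEntries(s,t)$: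 $s$ is secondary, $Len(log[t])>Len(log[s])$, and $log[s]$ is empty or $log[t]$ agrees with it at index $Len(log[s])$; then $log[t][Len(log[s])+1]$ is appended to $log[s]$. - $RollbackEntries(s,t)$: $s$ is secondary, $log[s]$ is non-empty, the last term of $log[s]$ is smaller than that of $log[t]$, and either $log[s]$ is longer than $log[t]$ or the two logs differ at index $Len(log[s])$; then the last entry of $log[s]$ is removed. - $CommitEntry(s,Q)$: $s$ is primary, $log[s]$ is non-empty with last term $term[s]$, and the entry $(Len(log[s]),term[s])$ is immediately committed on $Q$ and not in $committed$; it is added to $committed$. - $SendConfig(s,t)$: $t$ is secondary and the configuration of $s$ is newer than that of $t$; then $t$ adopts the member set, version and term of the configuration of $s$. - $Reconfig(s,m)$ for some $m\subseteq Server$: $s$ is primary; some quorum of $config[s]$ has the configuration version and term of $s$; some quorum of $config[s]$ has current term $term[s]$; $committed$ is empty or contains an entry with term $term[s]$; every committed entry with term $term[s]$ is immediately committed on some quorum of $config[s]$; every quorum of $config[s]$ intersects every quorum of $m$; and $s\in m$. Then $config[s]$ becomes $m$, $configVersion[s]$ increases by $1$, and $configTerm[s]$ becomes $term[s]$. - $BecomeLeader(s,Q)$: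 $s\in config[s]$, $s\in Q$, and every $v\in Q$ has $term[v]<term[s]+1$, a configuration not newer than that of $s$, and a log whose pair (last term, length) is lexicographically at most that of $s$. Then all $v\in Q$ get term $term[s]+1$, $s$ becomes primary, the other members of $Q$ become secondaries, and $configTerm[s]$ becomes $term[s]+1$, where $term[s]$ is the old value. - $UpdateTerms(s,t)$: $term[s]>term[t]$; then $term[t]$ becomes $term[s]$ and $t$ becomes secondary. Let $MRRSpec\triangleq MRRInit\wedge\square[MRRNext]_{vars}$, i.e. a behavior (infinite sequence of states) satisfies $MRRSpec$ iff its first state satisfies $MRRInit$ and each of its steps is an $MRRNext$ step or leaves the state unchanged. Then $$MRRSpec\Rightarrow\square\,StateMachineSafety,$$ that is, in every state of every behavior satisfying $MRRSpec$, for all $(ind_i,t_i),(ind_j,t_j)\in committed$, $ind_i=ind_j$ implies $t_i=t_j$. -/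

import Mathlib

/-! The MongoRaftReconfig protocol as a transition system over a finite set of servers, with its
behaviors in the sense of linear temporal logic. -/

namespace MongoRaftReconfig

/-! ## Temporal formulas -/

/-- A behavior is an infinite sequence of states. -/
abbrev Behavior (S : Type*) := ℕ → S

/-- A temporal formula is a predicate on behaviors. -/
abbrev TemporalFormula (S : Type*) := Behavior S → Prop

/-- A state predicate, read as a temporal formula, speaks about the first state. -/
def atFirst {S : Type*} (P : S → Prop) : TemporalFormula S := fun σ => P (σ 0)

/-- `[A]_vars`: the first step is an `A` step or a stuttering step. -/
def stepOrStutter {S : Type*} (A : S → S → Prop) : TemporalFormula S :=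
  fun σ => A (σ 0) (σ 1) ∨ σ 1 = σ 0

/-- `□ F`: the formula `F` holds of every suffix of the behavior. -/
def always {S : Type*} (F : TemporalFormula S) : TemporalFormula S :=
  fun σ => ∀ n, F (fun k => σ (n + k))

/-! ## States -/

/-- The two roles of a server. -/
inductive Role where
  | primary
  | secondary

/-- A state assigns a value to each of the seven state variables. -/
@[ext]
structure State (Server : Type*) where
  /-- The log of each server: the list of the terms of its entries. Indices start at 1. -/
  log : Server → List ℕ
  /-- The set of committed entries, as `(index, term)` pairs. -/
  committed : Set (ℕ × ℕ)
  /-- The current term of each server. -/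
  term : Server → ℕ
  /-- The role of each server. -/
  state : Server → Role
  /-- The member set of the configuration of each server. -/
  config : Server → Finset Server
  /-- The version of the configuration of each server. -/
  configVersion : Server → ℕ
  /-- The term of the configuration of each server. -/
  configTerm : Server → ℕ

section Protocol

variable {Server : Type*}

/-! ## Quorums and logs -/

/-- `Q` is a majority quorum of `m`, that is `Q ∈ Quorums(m)`. -/
def IsQuorum (m Q : Finset Server) : Prop := Q ⊆ m ∧ m.card < 2 * Q.card

/-- Every quorum of `m` intersects every quorum of `m'`. -/
def QuorumsOverlap (m m' : Finset Server) : Prop :=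
  ∀ Q Q', IsQuorum m Q → IsQuorum m' Q' → ∃ x, x ∈ Q ∧ x ∈ Q'

/-- The term of the entry at the (1-based) index `k` of the log `l`; 0 outside the log. -/
def termAt (l : List ℕ) : ℕ → ℕ
  | 0 => 0
  | k + 1 => l.getD k 0

/-- The term of the last entry of the log `l`, or 0 if `l` is empty. -/
def lastTerm (l : List ℕ) : ℕ := termAt l l.length

/-- The entry `(i, t)` is in the log of server `s`. -/
def InLog (σ : State Server) (i t : ℕ) (s : Server) : Prop :=
  1 ≤ i ∧ i ≤ (σ.log s).length ∧ termAt (σ.log s) i = t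

/-- All members of `Q` have the entry `(i, t)` in their log and are in term `t`. -/
def ImmediatelyCommitted (σ : State Server) (e : ℕ × ℕ) (Q : Finset Server) : Prop :=
  ∀ v ∈ Q, InLog σ e.1 e.2 v ∧ σ.term v = e.2

/-- Server `s` can roll back its last entry against the log of server `t`: the log of `t` has a
later last term and does not contain the last entry of `s`. -/
def CanRollback (σ : State Server) (s t : Server) : Prop :=
  0 < (σ.log s).length ∧
  lastTerm (σ.log s) < lastTerm (σ.log t) ∧
  ((σ.log t).length < (σ.log s).length ∨
    ((σ.log s).length ≤ (σ.log t).length ∧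
      lastTerm (σ.log s) ≠ termAt (σ.log t) (σ.log s).length))

/-- Voter `v` accepts the log of candidate `s` in an election for term `T`. -/
def CanVoteForOplog (σ : State Server) (v s : Server) (T : ℕ) : Prop :=
  σ.term v < T ∧
  (lastTerm (σ.log v) < lastTerm (σ.log s) ∨
    (lastTerm (σ.log s) = lastTerm (σ.log v) ∧ (σ.log v).length ≤ (σ.log s).length))

/-! ## Configurations -/

/-- The configuration of `s` is newer than that of `t`: terms are compared first, then
versions. -/
def IsNewerConfig (σ : State Server) (s t : Server) : Prop :=
  σ.configTerm t < σ.configTerm s ∨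
  (σ.configTerm s = σ.configTerm t ∧ σ.configVersion t < σ.configVersion s)

/-- The configuration of `s` is newer than that of `t`, or has the same version and term. -/
def IsNewerOrEqualConfig (σ : State Server) (s t : Server) : Prop :=
  (σ.configTerm s = σ.configTerm t ∧ σ.configVersion s = σ.configVersion t) ∨
  IsNewerConfig σ s t

/-- Voter `v` accepts the configuration of candidate `s` in an election for term `T`. -/
def CanVoteForConfig (σ : State Server) (v s : Server) (T : ℕ) : Prop :=
  σ.term v < T ∧ IsNewerOrEqualConfig σ s v

/-- A quorum of the configuration of `s` has installed the configuration of `s`. -/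
def ConfigQuorumCheck (σ : State Server) (s : Server) : Prop :=
  ∃ Q, IsQuorum (σ.config s) Q ∧
    ∀ v ∈ Q, σ.configVersion v = σ.configVersion s ∧ σ.configTerm v = σ.configTerm s

/-- A quorum of the configuration of `s` is in the term of `s`. -/
def TermQuorumCheck (σ : State Server) (s : Server) : Prop :=
  ∃ Q, IsQuorum (σ.config s) Q ∧ ∀ v ∈ Q, σ.term v = σ.term s

/-- Nothing is committed yet or some entry is committed in the term of `s`; and every entry
committed in the term of `s` is immediately committed on a quorum of the configuration of `s`. -/
def OplogCommitment (σ : State Server) (s : Server) : Prop :=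
  (σ.committed = ∅ ∨ ∃ c ∈ σ.committed, c.2 = σ.term s) ∧
  ∀ c ∈ σ.committed, c.2 = σ.term s →
    ∃ Q, IsQuorum (σ.config s) Q ∧ ImmediatelyCommitted σ c Q

/-! ## Actions: relations between the current state `σ` and the next state `σ'` -/

variable [DecidableEq Server]

/-- The primary `s` appends a new entry, in its term, to its log. -/
def ClientRequest (s : Server) (σ σ' : State Server) : Prop :=
  σ.state s = Role.primary ∧
  σ' = { σ with log := Function.update σ.log s (σ.log s ++ [σ.term s]) }

/-- The secondary `s` fetches the next entry from the longer log of `t`, provided that the log of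
`s` is empty or its last entry is also in the log of `t`. -/
def GetEntries (s t : Server) (σ σ' : State Server) : Prop :=
  σ.state s = Role.secondary ∧
  (σ.log s).length < (σ.log t).length ∧
  (σ.log s = [] ∨ termAt (σ.log t) (σ.log s).length = lastTerm (σ.log s)) ∧
  σ' = { σ with
          log := Function.update σ.log s
            (σ.log s ++ [termAt (σ.log t) ((σ.log s).length + 1)]) }

/-- The secondary `s` rolls back its last entry against the log of `t`. -/
def RollbackEntries (s t : Server) (σ σ' : State Server) : Prop :=
  σ.state s = Role.secondary ∧
  CanRollback σ s t ∧
  σ' = { σ with log := Function.update σ.log s (σ.log s).dropLast }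

/-- The primary `s` commits its last entry, which it wrote itself and which is immediately
committed on `Q`. -/
def CommitEntry (s : Server) (Q : Finset Server) (σ σ' : State Server) : Prop :=
  0 < (σ.log s).length ∧
  σ.state s = Role.primary ∧
  lastTerm (σ.log s) = σ.term s ∧
  ImmediatelyCommitted σ ((σ.log s).length, σ.term s) Q ∧
  ((σ.log s).length, σ.term s) ∉ σ.committed ∧
  σ' = { σ with committed := σ.committed ∪ {((σ.log s).length, σ.term s)} }

/-- The secondary `t` installs the newer configuration of `s`. -/
def SendConfig (s t : Server) (σ σ' : State Server) : Prop :=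
  σ.state t = Role.secondary ∧
  IsNewerConfig σ s t ∧
  σ' = { σ with
          config := Function.update σ.config t (σ.config s)
          configVersion := Function.update σ.configVersion t (σ.configVersion s)
          configTerm := Function.update σ.configTerm t (σ.configTerm s) }

/-- The primary `s` moves to a new configuration with member set `m`. -/
def Reconfig (s : Server) (m : Finset Server) (σ σ' : State Server) : Prop :=
  σ.state s = Role.primary ∧
  ConfigQuorumCheck σ s ∧
  TermQuorumCheck σ s ∧
  OplogCommitment σ s ∧
  QuorumsOverlap (σ.config s) m ∧
  s ∈ m ∧
  σ' = { σ with
          config := Function.update σ.config s m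
          configVersion := Function.update σ.configVersion s (σ.configVersion s + 1)
          configTerm := Function.update σ.configTerm s (σ.term s) }

/-- The server `s` is elected in the next term by the voters in `Q`, all of which move to that
term; the configuration of `s` is relabelled with the new term. -/
def BecomeLeader (s : Server) (Q : Finset Server) (σ σ' : State Server) : Prop :=
  s ∈ σ.config s ∧
  s ∈ Q ∧
  (∀ v ∈ Q, CanVoteForOplog σ v s (σ.term s + 1) ∧ CanVoteForConfig σ v s (σ.term s + 1)) ∧
  σ' = { σ with
          term := fun v => if v ∈ Q then σ.term s + 1 else σ.term v
          state := fun v =>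
            if v = s then Role.primary else if v ∈ Q then Role.secondary else σ.state v
          configTerm := Function.update σ.configTerm s (σ.term s + 1) }

/-- The newer term of `s` is propagated to `t`, which becomes a secondary. -/
def UpdateTerms (s t : Server) (σ σ' : State Server) : Prop :=
  σ.term t < σ.term s ∧
  σ' = { σ with
          term := Function.update σ.term t (σ.term s)
          state := Function.update σ.state t Role.secondary }

/-! ## Specification and safety property -/

/-- The initial states. -/
def MRRInit (σ : State Server) : Prop :=
  (∀ s, σ.log s = []) ∧
  σ.committed = ∅ ∧
  (∀ s, σ.term s = 0) ∧
  (∀ s, σ.state s = Role.secondary) ∧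
  (∃ m : Finset Server, m.Nonempty ∧ ∀ s, σ.config s = m) ∧
  (∀ s, σ.configVersion s = 1) ∧
  (∀ s, σ.configTerm s = 0)

/-- The next state relation. -/
def MRRNext (σ σ' : State Server) : Prop :=
  ∃ s t : Server, ∃ Q : Finset Server, IsQuorum (σ.config s) Q ∧
    (ClientRequest s σ σ' ∨
      GetEntries s t σ σ' ∨
      RollbackEntries s t σ σ' ∨
      CommitEntry s Q σ σ' ∨
      SendConfig s t σ σ' ∨
      (∃ m : Finset Server, Reconfig s m σ σ') ∨
      BecomeLeader s Q σ σ' ∨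
      UpdateTerms s t σ σ')

/-- `MRRInit ∧ □ [MRRNext]_vars`. -/
def MRRSpec : TemporalFormula (State Server) :=
  fun b => atFirst MRRInit b ∧ always (stepOrStutter MRRNext) b

/-- Two entries that are committed at the same index have the same term. -/
def StateMachineSafety (σ : State Server) : Prop :=
  ∀ ci ∈ σ.committed, ∀ cj ∈ σ.committed, ci.1 = cj.1 → ci.2 = cj.2

end Protocol

end MongoRaftReconfig

namespace MongoRaftReconfig

/-! ## Quorums -/

/-! Safety follows from an inductive invariant `Inv` built on active configurations: those with a
quorum in which nobody holds a newer one. Any quorums of two active configurations intersect, and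
every quorum of an active configuration contains a holder of each committed entry (`activeHas`).
Moreover, a log with an entry of a later term than a committed entry contains that committed entry
(`laterHas`). The newest configuration is active, so the later-term one of two committed entries is
in some log, which then contains the other too; they cannot share an index.

Elections succeed only under active configurations, so some voter holds each committed entry, and
the log comparison passes it on to the winner (`inLog_of_vote`). A superseded primary cannot commit:
once a configuration of a later term exists, each of its quorums has a member in a later term
(`olderDisabled`). Hence a committing quorum belongs to an active configuration and meets the
quorums of all others.

A reconfiguration is safe by its checks: the configuration quorum makes all older configurations
inactive, the term quorum excludes later configuration terms, and the log condition puts every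
committed entry on a quorum of the old configuration, which meets all quorums of the new one. -/

theorem IsQuorum.self {Server : Type*} {m : Finset Server} (h : m.Nonempty) : IsQuorum m m :=
  ⟨subset_rfl, by have := h.card_pos; omega⟩

theorem quorumsOverlap_self {Server : Type*} (m : Finset Server) : QuorumsOverlap m m := by
  classical
  intro Q Q' h h'
  have hu := Finset.card_union_add_card_inter Q Q'
  have hle := Finset.card_le_card (Finset.union_subset h.1 h'.1)
  have h2 := h.2
  have h2' := h'.2
  have hpos : 0 < (Q ∩ Q').card := by omega
  obtain ⟨x, hx⟩ := Finset.card_pos.1 hpos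
  exact ⟨x, Finset.mem_inter.1 hx⟩

theorem QuorumsOverlap.symm {Server : Type*} {m m' : Finset Server} (h : QuorumsOverlap m m') :
    QuorumsOverlap m' m := by
  intro Q Q' hQ hQ'
  obtain ⟨x, hx, hx'⟩ := h Q' Q hQ' hQ
  exact ⟨x, hx', hx⟩

/-! ## Logs -/

/-- The entry `(i, t)` is in the list `l`. -/
def HasEntry (l : List ℕ) (i t : ℕ) : Prop := 1 ≤ i ∧ i ≤ l.length ∧ termAt l i = t

theorem termAt_of_prefix {l l' : List ℕ} (h : l <+: l') {i : ℕ} (hi : i ≤ l.length) :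
    termAt l i = termAt l' i := by
  obtain ⟨r, rfl⟩ := h
  cases i with
  | zero => rfl
  | succ k => simp [termAt, List.getElem?_append_left (show k < l.length by omega)]

theorem hasEntry_prefix_iff {l l' : List ℕ} (h : l <+: l') {i t : ℕ} :
    HasEntry l i t ↔ HasEntry l' i t ∧ i ≤ l.length := by
  have hlen := h.length_le
  constructor
  · rintro ⟨h1, h2, h3⟩
    exact ⟨⟨h1, h2.trans hlen, termAt_of_prefix h h2 ▸ h3⟩, h2⟩
  · rintro ⟨⟨h1, -, h3⟩, h2⟩
    exact ⟨h1, h2, (termAt_of_prefix h h2).trans h3⟩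

theorem termAt_concat_length (l : List ℕ) (a : ℕ) : termAt (l ++ [a]) (l.length + 1) = a := by
  simp [termAt]

theorem hasEntry_concat_iff {l : List ℕ} {a i t : ℕ} :
    HasEntry (l ++ [a]) i t ↔ HasEntry l i t ∨ (i = l.length + 1 ∧ t = a) := by
  have hp := hasEntry_prefix_iff (l.prefix_append [a]) (i := i) (t := t)
  have ha := termAt_concat_length l a
  rw [hp]
  by_cases hi : i = l.length + 1
  · subst hi
    simp [HasEntry, ha, eq_comm]
  · constructor
    · exact fun h => Or.inl ⟨h, by have := h.2.1; simp at this; omega⟩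
    · rintro (h | h)
      · exact h.1
      · exact absurd h.1 hi

theorem prefix_of_termAt_eq {l l' : List ℕ} (hlen : l.length ≤ l'.length)
    (h : ∀ i, 1 ≤ i → i ≤ l.length → termAt l i = termAt l' i) : l <+: l' := by
  rw [List.prefix_iff_eq_take]
  apply List.ext_getElem
  · simp [hlen]
  · intro k hk hk'
    have := h (k + 1) (by omega) (by omega)
    simp only [termAt] at this
    simpa [hk, show k < l'.length by omega] using this

theorem concat_termAt_prefix {l l' : List ℕ} (hp : l <+: l') (hlen : l.length < l'.length) :
    l ++ [termAt l' (l.length + 1)] <+: l' := by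
  refine prefix_of_termAt_eq (by simpa using hlen) fun i hi hi' => ?_
  rcases Nat.lt_or_ge l.length i with h | h
  · obtain rfl : i = l.length + 1 := by simp at hi'; omega
    exact termAt_concat_length _ _
  · rw [← termAt_of_prefix (l.prefix_append _) h, termAt_of_prefix hp h]

section Protocol

variable {Server : Type*} {σ σ' : State Server}

theorem InLog.unique {i t t' : ℕ} {s : Server} (h : InLog σ i t s) (h' : InLog σ i t' s) :
    t = t' := h.2.2.symm.trans h'.2.2

/-! ## Invariants -/

/-- The configuration of `s` is active: some quorum of it has no newer configuration. -/
def Active (σ : State Server) (s : Server) : Prop :=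
  ∃ Q, IsQuorum (σ.config s) Q ∧ ∀ n ∈ Q, ¬ IsNewerConfig σ n s

/-- The invariants on terms, roles and configurations. -/
structure ConfigInv (σ : State Server) : Prop where
  nonempty : ∀ s, (σ.config s).Nonempty
  onePrimary : ∀ p q, σ.state p = Role.primary → σ.state q = Role.primary →
    σ.term p = σ.term q → p = q
  primaryTerm : ∀ p, σ.state p = Role.primary → σ.configTerm p = σ.term p
  config_unique : ∀ s t, σ.configTerm s = σ.configTerm t → σ.configVersion s = σ.configVersion t →
    σ.config s = σ.config t
  primaryNewest : ∀ p s, σ.state p = Role.primary → σ.configTerm s = σ.term p →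
    σ.configVersion s ≤ σ.configVersion p
  overlap : ∀ s t, Active σ s → Active σ t → QuorumsOverlap (σ.config s) (σ.config t)
  -- Forces the winner of an election under an active configuration into a term above all
  -- configuration terms.
  safeAtTerms : ∀ s t, Active σ t → ∀ Q, IsQuorum (σ.config t) Q →
    ∃ n ∈ Q, σ.configTerm s ≤ σ.term n

/-- The invariants on logs. -/
structure LogInv (σ : State Server) : Prop where
  matching : ∀ s s' i t, InLog σ i t s → InLog σ i t s' →
    ∀ j t', j ≤ i → InLog σ j t' s → InLog σ j t' s'
  sorted : ∀ s i j t t', InLog σ i t s → InLog σ j t' s → i ≤ j → t ≤ t'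
  -- The entries of a term come from one primary, so they start at the same index in every log that
  -- has any.
  uniform : ∀ s s' i j t, InLog σ i t s → InLog σ j t s' → i ≤ j → InLog σ i t s'
  primaryHas : ∀ p s i, σ.state p = Role.primary → InLog σ i (σ.term p) s →
    InLog σ i (σ.term p) p
  primaryLe : ∀ p i t, σ.state p = Role.primary → InLog σ i t p → t ≤ σ.term p
  -- Turns bounds on configuration terms into bounds on entry terms.
  configInTerm : ∀ s i t, InLog σ i t s → ∃ r, t ≤ σ.configTerm r

/-- The invariants on committed entries. -/
structure CommitInv (σ : State Server) : Prop where
  leaderComplete : ∀ p, ∀ c ∈ σ.committed, σ.state p = Role.primary → c.2 ≤ σ.term p →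
    InLog σ c.1 c.2 p
  laterHas : ∀ s, ∀ c ∈ σ.committed, ∀ i t, InLog σ i t s → c.2 < t → InLog σ c.1 c.2 s
  activeHas : ∀ s, ∀ c ∈ σ.committed, Active σ s → ∀ Q, IsQuorum (σ.config s) Q →
    ∃ n ∈ Q, InLog σ c.1 c.2 n
  olderDisabled : ∀ p s, σ.state p = Role.primary → σ.term p < σ.configTerm s →
    ∀ Q, IsQuorum (σ.config p) Q → ∃ n ∈ Q, σ.term p < σ.term n

/-- The inductive invariant of the protocol. -/
structure Inv (σ : State Server) : Prop where
  config : ConfigInv σ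
  log : LogInv σ
  commit : CommitInv σ

theorem Inv.of_init (h : MRRInit σ) : Inv σ := by
  obtain ⟨hl, hc, ht, hs, ⟨m, hm, hcfg⟩, hv, hct⟩ := h
  have hnl : ∀ i t s, ¬ InLog σ i t s := by
    rintro i t s ⟨h1, h2, -⟩
    simp [hl s] at h2
    omega
  refine ⟨⟨?_, ?_, ?_, ?_, ?_, ?_, ?_⟩, ⟨?_, ?_, ?_, ?_, ?_, ?_⟩, ⟨?_, ?_, ?_, ?_⟩⟩
  case refine_6 =>
    intro s t _ _
    rw [hcfg, hcfg]
    exact quorumsOverlap_self m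
  case refine_7 =>
    intro s t _ Q hQ
    obtain ⟨n, hn⟩ := Finset.card_pos.1 (show 0 < Q.card by have := hQ.2; omega)
    exact ⟨n, hn, by rw [hct, ht]⟩
  all_goals grind

/-- Configurations only become newer. -/
def ConfigMono (σ σ' : State Server) : Prop :=
  ∀ n, σ.configTerm n < σ'.configTerm n ∨
    (σ.configTerm n = σ'.configTerm n ∧ σ.configVersion n ≤ σ'.configVersion n)

/-- A superseded configuration is never revived: a server with a newer one before the step still has
a newer one after it. Allowing `r ≠ s` covers copied configurations. -/
theorem ConfigMono.active (h : ConfigMono σ σ') {r s : Server} (hc : σ'.config r = σ.config s)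
    (ht : σ'.configTerm r = σ.configTerm s) (hv : σ'.configVersion r = σ.configVersion s)
    (ha : Active σ' r) : Active σ s := by
  obtain ⟨Q, hQ, hn⟩ := ha
  refine ⟨Q, hc ▸ hQ, fun n hnQ hnew => hn n hnQ ?_⟩
  have := h n
  unfold IsNewerConfig at hnew ⊢
  omega

theorem ConfigQuorumCheck.active {s : Server} (h : ConfigQuorumCheck σ s) : Active σ s := by
  obtain ⟨Q, hQ, hn⟩ := h
  refine ⟨Q, hQ, fun n hnQ hnew => ?_⟩
  have := hn n hnQ
  unfold IsNewerConfig at hnew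
  omega

theorem ConfigInv.configTerm_le_of_check (hI : ConfigInv σ) {s : Server} (ha : Active σ s)
    (h : TermQuorumCheck σ s) (r : Server) : σ.configTerm r ≤ σ.term s := by
  obtain ⟨Q, hQ, hn⟩ := h
  obtain ⟨n, hnQ, hle⟩ := hI.safeAtTerms r s ha Q hQ
  exact hle.trans (hn n hnQ).le

/-- A primary whose configuration is not active is outvoted by a configuration of a later term. -/
theorem ConfigInv.later_of_not_active (hI : ConfigInv σ) {p : Server}
    (hp : σ.state p = Role.primary) (ha : ¬ Active σ p) {Q : Finset Server}
    (hQ : IsQuorum (σ.config p) Q) : ∃ r, σ.term p < σ.configTerm r := by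
  by_contra! hle
  refine ha ⟨Q, hQ, fun n _ hnew => ?_⟩
  -- With no later configuration term, a newer configuration would have the term of `p` and a larger
  -- version, against `primaryNewest`.
  have h1 := hI.primaryTerm p hp
  have h2 := hI.primaryNewest p n hp
  have h3 := hle n
  unfold IsNewerConfig at hnew
  omega

theorem ConfigInv.update_log (h : ConfigInv σ) (l : Server → List ℕ) :
    ConfigInv { σ with log := l } :=
  ⟨h.nonempty, h.onePrimary, h.primaryTerm, h.config_unique, h.primaryNewest, h.overlap,
    h.safeAtTerms⟩

/-! ## Actions on committed entries -/

theorem Inv.commitEntry (hI : Inv σ) {s : Server} {Q : Finset Server}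
    (hQ : IsQuorum (σ.config s) Q) (h : CommitEntry s Q σ σ') : Inv σ' := by
  obtain ⟨hpos, hs, hlast, himm, -, rfl⟩ := h
  obtain ⟨hC, hL, hK⟩ := hI
  -- A later configuration term would put a member of `Q` in a later term, but all of `Q` is in the
  -- term of `s`.
  have hle : ∀ r, σ.configTerm r ≤ σ.term s := by
    intro r
    by_contra! hlt
    obtain ⟨n, hn, hgt⟩ := hK.olderDisabled s r hs hlt Q hQ
    exact hgt.ne' (himm n hn).2
  have ha : Active σ s := by
    by_contra hna
    obtain ⟨r, hr⟩ := hC.later_of_not_active hs hna hQ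
    exact hr.not_ge (hle r)
  refine ⟨⟨hC.nonempty, hC.onePrimary, hC.primaryTerm, hC.config_unique, hC.primaryNewest,
    hC.overlap, hC.safeAtTerms⟩, ⟨hL.matching, hL.sorted, hL.uniform, hL.primaryHas, hL.primaryLe,
    hL.configInTerm⟩, ⟨?_, ?_, ?_, hK.olderDisabled⟩⟩
  · rintro p c (hc | rfl) hp hcp
    · exact hK.leaderComplete p c hc hp hcp
    -- A primary in at least this term is in exactly this term, hence is `s`.
    · have h1 := hle p
      rw [hC.primaryTerm p hp] at h1
      obtain rfl := hC.onePrimary s p hs hp (le_antisymm hcp h1)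
      exact ⟨hpos, le_rfl, hlast⟩
  · rintro r c (hc | rfl) i t hin hlt
    · exact hK.laterHas r c hc i t hin hlt
    · obtain ⟨q, hq⟩ := hL.configInTerm r i t hin
      exact absurd (hq.trans (hle q)) hlt.not_ge
  · rintro r c (hc | rfl) har Q' hQ'
    · exact hK.activeHas r c hc har Q' hQ'
    · obtain ⟨n, hn, hn'⟩ := hC.overlap s r ha har Q Q' hQ hQ'
      exact ⟨n, hn', (himm n hn).1⟩

/-! ## Safety -/

/-- Nothing is newer than the lexicographically largest pair of configuration term and version. -/
theorem exists_active [Finite Server] [Nonempty Server] (hC : ConfigInv σ) : ∃ s, Active σ s := by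
  obtain ⟨s, hs⟩ := Finite.exists_max fun s => toLex (σ.configTerm s, σ.configVersion s)
  refine ⟨s, σ.config s, IsQuorum.self (hC.nonempty s), fun n _ hnew => ?_⟩
  have := hs n
  rw [Prod.Lex.toLex_le_toLex] at this
  unfold IsNewerConfig at hnew
  simp only at this
  omega

theorem Inv.stateMachineSafety [Finite Server] [Nonempty Server] (hI : Inv σ) :
    StateMachineSafety σ := by
  have main : ∀ c ∈ σ.committed, ∀ d ∈ σ.committed, c.1 = d.1 → ¬ c.2 < d.2 := by
    intro c hc d hd hcd hlt
    obtain ⟨s, hs⟩ := exists_active hI.config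
    obtain ⟨n, -, hn⟩ := hI.commit.activeHas s d hd hs _ (IsQuorum.self (hI.config.nonempty s))
    have hn' := hI.commit.laterHas n c hc _ _ hn hlt
    rw [hcd] at hn'
    exact hlt.ne (hn'.unique hn)
  intro c hc d hd hcd
  have h1 := main c hc d hd hcd
  have h2 := main d hd c hc hcd.symm
  omega

/-! ## Elections -/

/-- The log of a candidate that wins the vote of `n` holds every committed entry of `n`. -/
theorem Inv.inLog_of_vote (hI : Inv σ) {n s : Server} {T : ℕ} (hv : CanVoteForOplog σ n s T)
    {c : ℕ × ℕ} (hc : c ∈ σ.committed) (hn : InLog σ c.1 c.2 n) : InLog σ c.1 c.2 s := by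
  replace hv := hv.2
  obtain ⟨h1, h2, h3⟩ := hn
  have hlast : InLog σ (σ.log n).length (lastTerm (σ.log n)) n := ⟨h1.trans h2, le_rfl, rfl⟩
  have hcl := hI.log.sorted n _ _ _ _ ⟨h1, h2, h3⟩ hlast h2
  have hs1 : 1 ≤ (σ.log s).length := by
    rcases hv with h | h
    · by_contra! h0
      -- The default last term 0 of an empty log exceeds no other last term.
      have h0' : (σ.log s).length = 0 := by omega
      rw [lastTerm.eq_1 (σ.log s), h0'] at h
      simp [termAt] at h
    · omega
  have hs : InLog σ (σ.log s).length (lastTerm (σ.log s)) s := ⟨hs1, le_rfl, rfl⟩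
  by_cases hlt : c.2 < lastTerm (σ.log s)
  · exact hI.commit.laterHas s c hc _ _ hs hlt
  -- Both last terms equal `c.2` here, so the vote compared lengths.
  · have heq : lastTerm (σ.log s) = c.2 := by omega
    rw [heq] at hs
    exact hI.log.uniform n s _ _ _ ⟨h1, h2, h3⟩ hs (by omega)

variable [DecidableEq Server]

/-- An elected server has an active configuration. -/
theorem BecomeLeader.active {s : Server} {Q : Finset Server} (h : BecomeLeader s Q σ σ')
    (hQ : IsQuorum (σ.config s) Q) : Active σ s := by
  obtain ⟨-, -, hv, -⟩ := h
  refine ⟨Q, hQ, fun n hn hnew => ?_⟩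
  have := (hv n hn).2.2
  unfold IsNewerOrEqualConfig at this
  unfold IsNewerConfig at this hnew
  omega

theorem BecomeLeader.configTerm_le (hI : ConfigInv σ) {s : Server} {Q : Finset Server}
    (h : BecomeLeader s Q σ σ') (hQ : IsQuorum (σ.config s) Q) (r : Server) :
    σ.configTerm r ≤ σ.term s := by
  obtain ⟨n, hn, hle⟩ := hI.safeAtTerms r s (h.active hQ) Q hQ
  have := (h.2.2.1 n hn).1.1
  omega

/-! ## Actions on logs -/

theorem inLog_update {s : Server} {l : List ℕ} {i t : ℕ} {r : Server} :
    InLog { σ with log := Function.update σ.log s l } i t r ↔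
      if r = s then HasEntry l i t else InLog σ i t r := by
  by_cases h : r = s
  · subst h; simp [InLog, HasEntry]
  · simp [InLog, h]

theorem Inv.clientRequest (hI : Inv σ) {s : Server} (h : ClientRequest s σ σ') : Inv σ' := by
  obtain ⟨hs, rfl⟩ := h
  obtain ⟨hC, hL, hK⟩ := hI
  set σ' : State Server := { σ with log := Function.update σ.log s (σ.log s ++ [σ.term s]) }
  have key : ∀ i t r, InLog σ' i t r ↔
      InLog σ i t r ∨ (r = s ∧ i = (σ.log s).length + 1 ∧ t = σ.term s) := by
    intro i t r
    rw [inLog_update, hasEntry_concat_iff]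
    by_cases hr : r = s
    · subst hr; simp [InLog, HasEntry]
    · simp [hr]
  -- The primary holds all entries of its term, so the appended pair is in no log yet.
  have hnew : ∀ r i, InLog σ i (σ.term s) r → i ≤ (σ.log s).length := fun r i hr =>
    (hL.primaryHas s r i hs hr).2.1
  have hlen : ∀ i t, InLog σ i t s → i ≤ (σ.log s).length := fun i t h => h.2.1
  have hst : σ'.state = σ.state := rfl
  have htm : σ'.term = σ.term := rfl
  have hct : σ'.configTerm = σ.configTerm := rfl
  have hcm : σ'.committed = σ.committed := rfl
  obtain ⟨l1, l2, l3, l4, l5, l6⟩ := hL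
  obtain ⟨c1, c2, c3, c4⟩ := hK
  have hp := hC.onePrimary
  have hpt := hC.primaryTerm
  refine ⟨hC.update_log _, ⟨?_, ?_, ?_, ?_, ?_, ?_⟩, ⟨?_, ?_, ?_, c4⟩⟩
  · simp only [key]
    grind
  · simp only [key]
    grind
  · simp only [key]
    grind
  · simp only [key, hst, htm]
    grind
  · simp only [key, hst, htm]
    grind
  · simp only [key, hct]
    rintro r i t (h | ⟨-, -, rfl⟩)
    · exact l6 r i t h
    · exact ⟨s, (hpt s hs).ge⟩
  · simp only [key, hst, htm, hcm]
    grind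
  · simp only [key, hcm]
    grind
  · intro r c hc ha Q hQ
    obtain ⟨n, hn, hin⟩ := c3 r c hc ha Q hQ
    exact ⟨n, hn, (key _ _ _).2 (Or.inl hin)⟩

/-- Replacing the log of a secondary by a prefix of some log, without losing a committed entry. -/
theorem Inv.copyLog (hI : Inv σ) {s t : Server} (hs : σ.state s = Role.secondary) {l : List ℕ}
    (hl : l <+: σ.log t)
    (hkeep : ∀ c ∈ σ.committed, InLog σ c.1 c.2 s → HasEntry l c.1 c.2) :
    Inv { σ with log := Function.update σ.log s l } := by
  obtain ⟨hC, hL, hK⟩ := hI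
  set σ' : State Server := { σ with log := Function.update σ.log s l }
  have key : ∀ i e r, InLog σ' i e r ↔
      if r = s then InLog σ i e t ∧ i ≤ l.length else InLog σ i e r := by
    intro i e r
    rw [inLog_update, hasEntry_prefix_iff hl]
    rfl
  have key' : ∀ i e, HasEntry l i e ↔ InLog σ i e t ∧ i ≤ l.length := by
    intro i e
    rw [hasEntry_prefix_iff hl]
    rfl
  have hst : σ'.state = σ.state := rfl
  have htm : σ'.term = σ.term := rfl
  have hct : σ'.configTerm = σ.configTerm := rfl
  have hcm : σ'.committed = σ.committed := rfl
  obtain ⟨l1, l2, l3, l4, l5, l6⟩ := hL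
  obtain ⟨c1, c2, c3, c4⟩ := hK
  have hps : ∀ p, σ.state p = Role.primary → p ≠ s := by
    rintro p hp rfl
    simp [hp] at hs
  refine ⟨hC.update_log _, ⟨?_, ?_, ?_, ?_, ?_, ?_⟩, ⟨?_, ?_, ?_, c4⟩⟩
  · simp only [key]
    grind
  · simp only [key]
    grind
  · simp only [key]
    grind
  · simp only [key, hst, htm]
    grind
  · simp only [key, hst, htm]
    grind
  · simp only [key, hct]
    grind
  · simp only [key, hst, htm, hcm]
    grind
  · simp only [key, hcm]
    intro r c hc i e he hlt
    split_ifs at he ⊢ with hr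
    · have hin := c2 t c hc i e he.1 hlt
      refine ⟨hin, ?_⟩
      -- A committed entry beyond the prefix would lie after index `i` with a smaller term, against
      -- sortedness.
      by_contra! hgt
      have := l2 t i c.1 e c.2 he.1 hin (by omega)
      omega
    · exact c2 r c hc i e he hlt
  · intro r c hc ha Q hQ
    obtain ⟨n, hn, hin⟩ := c3 r c hc ha Q hQ
    refine ⟨n, hn, (key _ _ _).2 ?_⟩
    split_ifs with h
    · exact (key' _ _).1 (hkeep c hc (h ▸ hin))
    · exact hin

theorem Inv.getEntries (hI : Inv σ) {s t : Server} (h : GetEntries s t σ σ') : Inv σ' := by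
  obtain ⟨hs, hlen, hlast, rfl⟩ := h
  have hp : σ.log s <+: σ.log t := by
    rcases hlast with h | h
    · simp [h]
    · refine prefix_of_termAt_eq hlen.le fun i hi hi' => ?_
      have hlast : 1 ≤ (σ.log s).length := hi.trans hi'
      exact (hI.log.matching s t _ _ ⟨hlast, le_rfl, rfl⟩ ⟨hlast, hlen.le, h⟩ i _ hi'
        ⟨hi, hi', rfl⟩).2.2.symm
  exact hI.copyLog hs (concat_termAt_prefix hp hlen) fun c _ hc =>
    hasEntry_concat_iff.2 (Or.inl hc)

theorem Inv.rollbackEntries (hI : Inv σ) {s t : Server} (h : RollbackEntries s t σ σ') :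
    Inv σ' := by
  obtain ⟨hs, ⟨hpos, hlt, hdiff⟩, rfl⟩ := h
  have hpre := List.dropLast_prefix (σ.log s)
  refine hI.copyLog hs hpre fun c hc hin => (hasEntry_prefix_iff hpre).2 ⟨hin, ?_⟩
  -- A committed entry that gets lost is the last one of `s`; `laterHas` puts it in the log of `t`,
  -- against the rollback condition.
  by_contra! hgt
  have hc1 : c.1 = (σ.log s).length := by
    have := hin.2.1
    simp at hgt
    omega
  have ht : InLog σ (σ.log t).length (lastTerm (σ.log t)) t := by
    refine ⟨?_, le_rfl, rfl⟩
    by_contra! h0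
    have h0' : (σ.log t).length = 0 := by omega
    simp [lastTerm, h0', termAt] at hlt
  have hct : c.2 = lastTerm (σ.log s) := by
    rw [lastTerm, ← hc1]
    exact hin.2.2.symm
  have := hI.commit.laterHas t c hc _ _ ht (by omega)
  obtain ⟨-, h2, h3⟩ := this
  rw [hc1] at h2 h3
  omega

/-! ## Actions on configurations and terms -/

theorem Inv.sendConfig (hI : Inv σ) {s t : Server} (h : SendConfig s t σ σ') : Inv σ' := by
  obtain ⟨ht, hnew, rfl⟩ := h
  obtain ⟨hC, hL, hK⟩ := hI
  set σ' : State Server := { σ with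
    config := Function.update σ.config t (σ.config s)
    configVersion := Function.update σ.configVersion t (σ.configVersion s)
    configTerm := Function.update σ.configTerm t (σ.configTerm s) }
  -- Every configuration after the step existed before it, and primaries keep theirs because `t` is
  -- a secondary.
  have src : ∀ r, ∃ r', σ'.config r = σ.config r' ∧ σ'.configVersion r = σ.configVersion r' ∧
      σ'.configTerm r = σ.configTerm r' ∧ (σ.state r = Role.primary → r' = r) := by
    intro r
    by_cases hr : r = t
    · subst hr
      exact ⟨s, by simp [σ'], by simp [σ'], by simp [σ'], by simp [ht]⟩
    · exact ⟨r, by simp [σ', hr], by simp [σ', hr], by simp [σ', hr], fun _ => rfl⟩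
  have mono : ConfigMono σ σ' := by
    intro r
    unfold IsNewerConfig at hnew
    by_cases hr : r = t
    · subst hr
      simp only [σ', Function.update_self]
      omega
    · simp [σ', hr]
  choose f hcf hvf htf hpf using src
  have act : ∀ r, Active σ' r → Active σ (f r) := fun r =>
    mono.active (hcf r) (htf r) (hvf r)
  refine ⟨⟨?_, hC.onePrimary, ?_, ?_, ?_, ?_, ?_⟩, ⟨hL.matching, hL.sorted, hL.uniform,
    hL.primaryHas, hL.primaryLe, ?_⟩, ⟨hK.leaderComplete, hK.laterHas, ?_, ?_⟩⟩
  · intro r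
    rw [hcf]
    exact hC.nonempty _
  · intro p hp
    rw [htf, hpf p hp]
    exact hC.primaryTerm p hp
  · intro r q
    rw [hcf, hcf, htf, htf, hvf, hvf]
    exact hC.config_unique _ _
  · intro p r hp
    rw [htf, hvf, hvf, hpf p hp]
    exact hC.primaryNewest p _ hp
  · intro r q hr hq
    rw [hcf, hcf]
    exact hC.overlap _ _ (act r hr) (act q hq)
  · intro r q hq
    rw [hcf, htf]
    exact hC.safeAtTerms _ _ (act q hq)
  · intro r i e hin
    obtain ⟨q, hq⟩ := hL.configInTerm r i e hin
    refine ⟨q, hq.trans ?_⟩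
    rcases mono q with h | h
    · exact h.le
    · exact h.1.le
  · intro r c hc hr
    rw [hcf]
    exact hK.activeHas _ c hc (act r hr)
  · intro p r hp
    rw [htf, hcf, hpf p hp]
    exact hK.olderDisabled p _ hp

theorem Inv.reconfig (hI : Inv σ) {s : Server} {m : Finset Server} (h : Reconfig s m σ σ') :
    Inv σ' := by
  obtain ⟨hs, hcq, htq, hop, hov, hsm, rfl⟩ := h
  obtain ⟨hC, hL, hK⟩ := hI
  have hsa := hcq.active
  have hle := hC.configTerm_le_of_check hsa htq
  have hts := hC.primaryTerm s hs
  obtain ⟨QC, hQC, hQCv⟩ := hcq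
  obtain ⟨QT, hQT, hQTt⟩ := htq
  set σ' : State Server := { σ with
    config := Function.update σ.config s m
    configVersion := Function.update σ.configVersion s (σ.configVersion s + 1)
    configTerm := Function.update σ.configTerm s (σ.term s) }
  -- The configuration term of a primary is already its term.
  have hT : σ'.configTerm = σ.configTerm := by
    simp only [σ', ← hts, Function.update_eq_self]
  have hcs : σ'.config s = m := by simp [σ']
  have hvs : σ'.configVersion s = σ.configVersion s + 1 := by simp [σ']
  have hcr : ∀ r, r ≠ s → σ'.config r = σ.config r := fun r hr => by simp [σ', hr]
  have hvr : ∀ r, r ≠ s → σ'.configVersion r = σ.configVersion r := fun r hr => by simp [σ', hr]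
  have mono : ConfigMono σ σ' := by
    intro r
    right
    refine ⟨by rw [hT], ?_⟩
    by_cases hr : r = s
    · subst hr; omega
    · rw [hvr r hr]
  have act : ∀ r, r ≠ s → Active σ' r → Active σ r := fun r hr =>
    mono.active (hcr r hr) (by rw [hT]) (hvr r hr)
  have hnewest : ∀ r, σ.configTerm r = σ.term s → σ.configVersion r ≤ σ.configVersion s :=
    fun r => hC.primaryNewest s r hs
  have hovr : ∀ r, r ≠ s → Active σ' r → QuorumsOverlap m (σ.config r) := by
    intro r hr har
    have har' := act r hr har
    have h1 := hle r
    have h2 := hnewest r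
    by_cases heq : σ.configTerm r = σ.configTerm s ∧ σ.configVersion r = σ.configVersion s
    · rw [hC.config_unique r s heq.1 heq.2]
      exact hov.symm
    -- Here the configuration of `r` is older than that of `s`, but its quorums meet `QC`, which has
    -- installed the latter.
    · exfalso
      obtain ⟨Q, hQ, hn⟩ := har'
      obtain ⟨n, hn1, hn2⟩ := hC.overlap s r hsa (act r hr har) QC Q hQC hQ
      refine hn n hn2 ?_
      have := hQCv n hn1
      unfold IsNewerConfig
      omega
  refine ⟨⟨?_, hC.onePrimary, ?_, ?_, ?_, ?_, ?_⟩, ⟨hL.matching, hL.sorted, hL.uniform,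
    hL.primaryHas, hL.primaryLe, ?_⟩, ⟨hK.leaderComplete, hK.laterHas, ?_, ?_⟩⟩
  · intro r
    by_cases hr : r = s
    · subst hr
      rw [hcs]
      exact ⟨r, hsm⟩
    · rw [hcr r hr]
      exact hC.nonempty r
  · intro p hp
    rw [hT]
    exact hC.primaryTerm p hp
  · have := hC.config_unique
    rw [hT]
    intro r q
    by_cases hr : r = s <;> by_cases hq : q = s
    · simp [hr, hq]
    · subst hr
      have := hnewest q
      rw [hvs, hvr q hq]
      omega
    · subst hq
      have := hnewest r
      rw [hvs, hvr r hr]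
      omega
    · rw [hvr r hr, hvr q hq, hcr r hr, hcr q hq]
      exact this r q
  · rw [hT]
    intro p r hp hpr
    change σ.configTerm r = σ.term p at hpr
    have h1 := hC.primaryNewest p r hp hpr
    by_cases hr : r = s
    · subst hr
      rw [hC.onePrimary p r hp hs (by omega)]
    · rw [hvr r hr]
      rcases mono p with h | h
      · rw [hT] at h; omega
      · omega
  · intro r q har haq
    by_cases hr : r = s <;> by_cases hq : q = s
    · rw [hr, hq]
      exact quorumsOverlap_self _
    · rw [hr, hcs, hcr q hq]
      exact hovr q hq haq
    · rw [hq, hcs, hcr r hr]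
      exact (hovr r hr har).symm
    · rw [hcr r hr, hcr q hq]
      exact hC.overlap r q (act r hr har) (act q hq haq)
  · rw [hT]
    intro r q haq Q hQ
    by_cases hq : q = s
    · rw [hq, hcs] at hQ
      obtain ⟨n, hn, hn'⟩ := hov QT Q hQT hQ
      exact ⟨n, hn', (hle r).trans (hQTt n hn).ge⟩
    · rw [hcr q hq] at hQ
      exact hC.safeAtTerms r q (act q hq haq) Q hQ
  · rw [hT]
    exact hL.configInTerm
  · intro r c hc har Q hQ
    by_cases hr : r = s
    · rw [hr, hcs] at hQ
      obtain ⟨hop1, hop2⟩ := hop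
      rcases lt_trichotomy c.2 (σ.term s) with hlt | heq | hgt
      -- An entry of an older term is carried by one committed in the current term: whoever holds
      -- `c0` holds `c`.
      · obtain ⟨c0, hc0, hc0t⟩ := hop1.resolve_left (Set.nonempty_iff_ne_empty.1 ⟨c, hc⟩)
        obtain ⟨Q0, hQ0, h0⟩ := hop2 c0 hc0 hc0t
        obtain ⟨n, hn, hn'⟩ := hov Q0 Q hQ0 hQ
        exact ⟨n, hn', hK.laterHas n c hc _ _ (h0 n hn).1 (by omega)⟩
      · obtain ⟨Q0, hQ0, h0⟩ := hop2 c hc heq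
        obtain ⟨n, hn, hn'⟩ := hov Q0 Q hQ0 hQ
        exact ⟨n, hn', (h0 n hn).1⟩
      -- Impossible: the entry is in some log, so some configuration term would exceed the term of
      -- `s`.
      · obtain ⟨n, -, hn⟩ := hK.activeHas s c hc hsa QT hQT
        obtain ⟨q, hq⟩ := hL.configInTerm n _ _ hn
        exact absurd (hq.trans (hle q)) hgt.not_ge
    · rw [hcr r hr] at hQ
      exact hK.activeHas r c hc (act r hr har) Q hQ
  · rw [hT]
    intro p r hp hlt
    by_cases hp' : p = s
    · subst hp'
      exact absurd (hle r) hlt.not_ge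
    · rw [hcr p hp']
      exact hK.olderDisabled p r hp hlt

/-- Terms only grow, and every server that is still primary keeps its term. -/
theorem Inv.updateTerms (hI : Inv σ) {s t : Server} (h : UpdateTerms s t σ σ') : Inv σ' := by
  obtain ⟨hlt, rfl⟩ := h
  obtain ⟨hC, hL, hK⟩ := hI
  set σ' : State Server := { σ with
    term := Function.update σ.term t (σ.term s)
    state := Function.update σ.state t Role.secondary }
  have prim : ∀ p, σ'.state p = Role.primary → σ.state p = Role.primary ∧ σ'.term p = σ.term p := by
    intro p hp
    by_cases h : p = t
    · subst h; simp [σ'] at hp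
    · simpa [σ', h] using hp
  have mono : ∀ n, σ.term n ≤ σ'.term n := by
    intro n
    by_cases h : n = t
    · subst h; simpa [σ'] using hlt.le
    · simp [σ', h]
  refine ⟨⟨hC.nonempty, ?_, ?_, hC.config_unique, ?_, hC.overlap, ?_⟩,
    ⟨hL.matching, hL.sorted, hL.uniform, ?_, ?_, hL.configInTerm⟩,
    ⟨?_, hK.laterHas, hK.activeHas, ?_⟩⟩
  · intro p q hp hq
    rw [(prim p hp).2, (prim q hq).2]
    exact hC.onePrimary p q (prim p hp).1 (prim q hq).1
  · intro p hp
    rw [(prim p hp).2]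
    exact hC.primaryTerm p (prim p hp).1
  · intro p r hp
    rw [(prim p hp).2]
    exact hC.primaryNewest p r (prim p hp).1
  · intro r q ha Q hQ
    obtain ⟨n, hn, hle⟩ := hC.safeAtTerms r q ha Q hQ
    exact ⟨n, hn, hle.trans (mono n)⟩
  · intro p r i hp
    rw [(prim p hp).2]
    exact hL.primaryHas p r i (prim p hp).1
  · intro p i e hp
    rw [(prim p hp).2]
    exact hL.primaryLe p i e (prim p hp).1
  · intro p c hc hp
    rw [(prim p hp).2]
    exact hK.leaderComplete p c hc (prim p hp).1
  · intro p r hp hr Q hQ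
    rw [(prim p hp).2] at hr ⊢
    obtain ⟨n, hn, hle⟩ := hK.olderDisabled p r (prim p hp).1 hr Q hQ
    exact ⟨n, hn, hle.trans_le (mono n)⟩

theorem Inv.becomeLeader (hI : Inv σ) {s : Server} {Q : Finset Server}
    (hQ : IsQuorum (σ.config s) Q) (h : BecomeLeader s Q σ σ') : Inv σ' := by
  have hsa := h.active hQ
  have hle := h.configTerm_le hI.config hQ
  obtain ⟨-, hsQ, hv, rfl⟩ := h
  have hvote := fun c hc n (hn : n ∈ Q) => hI.inLog_of_vote (c := c) (hv n hn).1 hc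
  obtain ⟨hC, hL, hK⟩ := hI
  set σ' : State Server := { σ with
    term := fun v => if v ∈ Q then σ.term s + 1 else σ.term v
    state := fun v =>
      if v = s then Role.primary else if v ∈ Q then Role.secondary else σ.state v
    configTerm := Function.update σ.configTerm s (σ.term s + 1) }
  have hTs : σ'.configTerm s = σ.term s + 1 := by simp [σ']
  have hTr : ∀ r, r ≠ s → σ'.configTerm r = σ.configTerm r := fun r hr => by simp [σ', hr]
  have hts : σ'.term s = σ.term s + 1 := by simp [σ', hsQ]
  have htQ : ∀ n ∈ Q, σ'.term n = σ.term s + 1 := fun n hn => by simp [σ', hn]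
  have mono : ∀ n, σ.term n ≤ σ'.term n := by
    intro n
    by_cases h : n ∈ Q
    · rw [htQ n h]
      exact (hv n h).1.1.le
    · simp [σ', h]
  have prim : ∀ p, σ'.state p = Role.primary → p ≠ s →
      σ.state p = Role.primary ∧ σ'.term p = σ.term p := by
    intro p hp hps
    by_cases h : p ∈ Q
    · simp [σ', hps, h] at hp
    · simpa [σ', hps, h] using hp
  have primlt : ∀ p, σ.state p = Role.primary → σ.term p ≤ σ.term s := fun p hp =>
    (hC.primaryTerm p hp).ge.trans (hle p)
  have entle : ∀ r i e, InLog σ i e r → e ≤ σ.term s := fun r i e h => by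
    obtain ⟨q, hq⟩ := hL.configInTerm r i e h
    exact hq.trans (hle q)
  have cmono : ConfigMono σ σ' := by
    intro r
    by_cases hr : r = s
    · subst hr
      have := hle r
      omega
    · rw [hTr r hr]
      exact Or.inr ⟨rfl, le_rfl⟩
  have act : ∀ r, Active σ' r → Active σ r := by
    intro r har
    by_cases hr : r = s
    · exact hr ▸ hsa
    · exact cmono.active rfl (hTr r hr) rfl har
  refine ⟨⟨hC.nonempty, ?_, ?_, ?_, ?_, ?_, ?_⟩, ⟨hL.matching, hL.sorted, hL.uniform, ?_, ?_, ?_⟩,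
    ⟨?_, hK.laterHas, ?_, ?_⟩⟩
  · have := hC.onePrimary
    grind
  · have := hC.primaryTerm
    grind
  · intro r q hrq hver
    by_cases hr : r = s <;> by_cases hq : q = s
    · rw [hr, hq]
    · rw [hr, hTs, hTr q hq] at hrq
      have := hle q
      omega
    · rw [hq, hTs, hTr r hr] at hrq
      have := hle r
      omega
    · rw [hTr r hr, hTr q hq] at hrq
      exact hC.config_unique r q hrq hver
  · intro p r hp hrp
    by_cases hps : p = s <;> by_cases hr : r = s
    · rw [hps, hr]
    · rw [hps, hts, hTr r hr] at hrp
      have := hle r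
      omega
    · obtain ⟨hp1, hp2⟩ := prim p hp hps
      rw [hr, hTs, hp2] at hrp
      have := primlt p hp1
      omega
    · obtain ⟨hp1, hp2⟩ := prim p hp hps
      rw [hTr r hr, hp2] at hrp
      exact hC.primaryNewest p r hp1 hrp
  · intro r q hr hq
    exact hC.overlap r q (act r hr) (act q hq)
  · intro r q hq Q' hQ'
    by_cases hr : r = s
    · obtain ⟨n, hn, hn'⟩ := hC.overlap s q hsa (act q hq) Q Q' hQ hQ'
      exact ⟨n, hn', by rw [hr, hTs, htQ n hn]⟩
    · obtain ⟨n, hn, hn'⟩ := hC.safeAtTerms r q (act q hq) Q' hQ'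
      rw [hTr r hr]
      exact ⟨n, hn, hn'.trans (mono n)⟩
  · intro p r i hp hin
    by_cases hps : p = s
    · rw [hps, hts] at hin
      have := entle r i _ hin
      omega
    · obtain ⟨hp1, hp2⟩ := prim p hp hps
      rw [hp2] at hin ⊢
      exact hL.primaryHas p r i hp1 hin
  · intro p i e hp hin
    by_cases hps : p = s
    · rw [hps, hts]
      exact (entle p i e hin).trans (Nat.le_succ _)
    · obtain ⟨hp1, hp2⟩ := prim p hp hps
      rw [hp2]
      exact hL.primaryLe p i e hp1 hin
  · intro r i e hin
    exact ⟨s, by rw [hTs]; exact (entle r i e hin).trans (Nat.le_succ _)⟩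
  · intro p c hc hp hcp
    by_cases hps : p = s
    · obtain ⟨n, hn, hin⟩ := hK.activeHas s c hc hsa Q hQ
      rw [hps]
      exact hvote c hc n hn hin
    · obtain ⟨hp1, hp2⟩ := prim p hp hps
      rw [hp2] at hcp
      exact hK.leaderComplete p c hc hp1 hcp
  · intro r c hc hr
    exact hK.activeHas r c hc (act r hr)
  · intro p r hp hlt Q' hQ'
    by_cases hps : p = s
    · exfalso
      rw [hps, hts] at hlt
      by_cases hr : r = s
      · rw [hr, hTs] at hlt
        omega
      · rw [hTr r hr] at hlt
        have := hle r
        omega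
    · obtain ⟨hp1, hp2⟩ := prim p hp hps
      rw [hp2] at hlt ⊢
      -- The quorums of an active configuration meet `Q`, which has moved to the new term; an
      -- inactive one was already disabled by a later configuration.
      by_cases hap : Active σ p
      · obtain ⟨n, hn, hn'⟩ := hC.overlap s p hsa hap Q Q' hQ hQ'
        refine ⟨n, hn', ?_⟩
        rw [htQ n hn]
        exact Nat.lt_succ_of_le (primlt p hp1)
      · obtain ⟨q, hq⟩ := hC.later_of_not_active hp1 hap hQ'
        obtain ⟨n, hn, hn'⟩ := hK.olderDisabled p q hp1 hq Q' hQ'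
        exact ⟨n, hn, hn'.trans_le (mono n)⟩

/-! ## Every reachable state satisfies the invariant -/

theorem Inv.next (hI : Inv σ) (h : MRRNext σ σ') : Inv σ' := by
  obtain ⟨s, t, Q, hQ, h | h | h | h | h | ⟨m, h⟩ | h | h⟩ := h
  · exact hI.clientRequest h
  · exact hI.getEntries h
  · exact hI.rollbackEntries h
  · exact hI.commitEntry hQ h
  · exact hI.sendConfig h
  · exact hI.reconfig h
  · exact hI.becomeLeader hQ h
  · exact hI.updateTerms h

theorem MRRSpec.inv {b : Behavior (State Server)} (h : MRRSpec b) (n : ℕ) : Inv (b n) := by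
  induction n with
  | zero => exact Inv.of_init h.1
  | succ n ih =>
    rcases h.2 n with hn | hn
    · exact ih.next hn
    · change b (n + 1) = b n at hn
      rwa [hn]

end Protocol

end MongoRaftReconfig

theorem theorem2 {Server : Type*} [Fintype Server] [DecidableEq Server]
    (b : MongoRaftReconfig.Behavior (MongoRaftReconfig.State Server))
    (hspec : MongoRaftReconfig.MRRSpec b) :
    MongoRaftReconfig.always
      (MongoRaftReconfig.atFirst MongoRaftReconfig.StateMachineSafety) b := by
  intro n
  -- The non-empty initial member set supplies a server.
  obtain ⟨m, ⟨x, -⟩, -⟩ := hspec.1.2.2.2.2.1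
  have : Nonempty Server := ⟨x⟩
  exact (hspec.inv n).stateMachineSafety
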